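/- Let $\wp$ be the Weierstrass function with periods $(2\omega_1,2\omega_3)$ ($\omega_1,\omega_3\in\mathbb C$ linearly independent over $\mathbb R$), $\omega_0=0$, $\omega_2=-\omega_1-\omega_3$, and $e_k=\wp(\omega_k)$ for $k=1,2,3$. For $l=(l_0,l_1,l_2,l_3)\in\mathbb C^4$ put $$H^{(l_0,l_1,l_2,l_3)}=-\frac{d^2}{dx^2}+\sum_{i=0}^3 l_i(l_i+1)\wp(x+\omega_i).$$ For $\beta=(\beta_0,\beta_1,\beta_2,\beta_3)\in\mathbb C^4$ and $d\in\mathbb Z_{\ge 0}$ with $d=-\sum_{i=0}^3\beta_i/2$, put $\Phi_\beta(x)=\prod_{k=1}^3(\wp(x)-e_k)^{\beta_k/2}$, let $V_{\beta}$ be the space spanned by the functions $\Phi_\beta(x)\wp(x)^n$ $(n=0,\dots,d)$, and let $L_\beta$ be the monic differential operator of order $d+1$ $$L_{\beta}=\wp'(x)^{d+1}\,\Phi_\beta(x)\circ\left(\frac1{\wp'(x)}\frac{d}{dx}\right)^{d+1}\circ\Phi_\beta(x)^{-1}.$$ Here all functions are considered on an arbitrary domain $U\subset\mathbb C$ (open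 and connected) that contains no point of $\omega_1\mathbb Z+\omega_3\mathbb Z$ and on which holomorphic branches of $\log(\wp-e_k)$ $(k=1,2,3)$ exist and have been chosen; they define the powers above. Let $l\in\mathbb C^4$, let $\alpha_i\in\{-l_i,\,l_i+1\}$ for $i=0,1,2,3$, and assume that $d=-\sum_{i=0}^3\alpha_i/2\in\mathbb Z_{\ge0}$. Write $\alpha+d=(\alpha_0+d,\dots,\alpha_3+d)$ and $-\alpha-d=(-\alpha_0-d,\dots,-\alpha_3-d)$; note that $d=-\sum_i(-\alpha_i-d)/2$. Then: (i) $H^{(l_0,l_1,l_2,l_3)}\,L_{-\alpha-d}=L_{-\alpha-d}\,H^{(\alpha_0+d,\alpha_1+d,\alpha_2+d,\alpha_3+d)}$ as operators on the holomorphic functions on $U$. (ii) The spaces $V_{\alpha}$ and $V_{-\alpha-d}$ are $(d+1)$-dimensional and preserved by $H^{(l_0,l_1,l_2,l_3)}$ and $H^{(\alpha_0+d,\alpha_1+d,\alpha_2+d,\alpha_3+d)}$ respectively, and the characteristic polynomial of $H^{(l_0,l_1,l_2,l_3)}$ on $V_{\alpha}$ equals that of $H^{(\alpha_0+d,\alpha_1+d,\alpha_2+d,\alpha_3+d)}$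 on $V_{-\alpha-d}$. -/

import Mathlib

namespace HeunDarboux

noncomputable section

/-- The half periods `ω₀ = 0, ω₁, ω₂ = -ω₁ - ω₃, ω₃` of the lattice with basic periods
`(2ω₁, 2ω₃) = (P.ω₁, P.ω₂)`. -/
def halfPeriod (P : PeriodPair) : Fin 4 → ℂ :=
  ![0, P.ω₁ / 2, -(P.ω₁ / 2) - P.ω₂ / 2, P.ω₂ / 2]

/-- The values `e₁, e₂, e₃`, indexed by `0, 1, 2 : Fin 3`: `e_k = ℘(ω_k)`. -/
def e (P : PeriodPair) (i : Fin 3) : ℂ := P.weierstrassP (halfPeriod P i.succ)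

/-- Extension by zero of a function on `U` to the whole plane. -/
def zeroExt {U : Set ℂ} (f : U → ℂ) : ℂ → ℂ := Function.extend Subtype.val f 0

/-- The function `f` on the (open) set `U` is holomorphic. -/
def IsHolo {U : Set ℂ} (f : U → ℂ) : Prop := DifferentiableOn ℂ (zeroExt f) U

/-- `d/dx` on functions on an open set `U`; the derivative at a point of `U` depends only on the
values of the function near the point, hence not on the extension. -/
def ddx {U : Set ℂ} (f : U → ℂ) : U → ℂ := fun x => deriv (zeroExt f) x

/-- The operator `H^{(l₀,l₁,l₂,l₃)} = -d²/dx² + ∑ lᵢ (lᵢ + 1) ℘(x + ωᵢ)` on functions on `U`. -/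
def hamiltonian (P : PeriodPair) (l : Fin 4 → ℂ) {U : Set ℂ} (f : U → ℂ) : U → ℂ := fun x =>
  -ddx (ddx f) x +
    (∑ i, l i * (l i + 1) * P.weierstrassP ((x : ℂ) + halfPeriod P i)) * f x

/-- `lg 0, lg 1, lg 2` are holomorphic branches on `U` of the logarithms of
`℘ - e₁`, `℘ - e₂`, `℘ - e₃`. -/
structure IsLogBranch (P : PeriodPair) (U : Set ℂ) (lg : Fin 3 → ℂ → ℂ) : Prop where
  differentiableOn : ∀ i, DifferentiableOn ℂ (lg i) U
  exp_eq : ∀ i, ∀ x ∈ U, Complex.exp (lg i x) = P.weierstrassP x - e P i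

/-- The function `(℘ - e₁)^{α₁/2} (℘ - e₂)^{α₂/2} (℘ - e₃)^{α₃/2}` on `U`, the powers being
given by the chosen branches of the logarithms. -/
def gauge (U : Set ℂ) (lg : Fin 3 → ℂ → ℂ) (α : Fin 4 → ℂ) : U → ℂ := fun x =>
  ∏ i : Fin 3, Complex.exp (α i.succ / 2 * lg i x)

/-- The space `V_{α₀,α₁,α₂,α₃}` of functions on `U`, spanned by
`(℘ - e₁)^{α₁/2} (℘ - e₂)^{α₂/2} (℘ - e₃)^{α₃/2} ℘ⁿ`, `n = 0, …, d`. -/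
def V (P : PeriodPair) (U : Set ℂ) (lg : Fin 3 → ℂ → ℂ) (α : Fin 4 → ℂ) (d : ℕ) :
    Submodule ℂ (U → ℂ) :=
  Submodule.span ℂ (Set.range fun (n : Fin (d + 1)) (x : U) =>
    gauge U lg α x * P.weierstrassP x ^ (n : ℕ))

instance (P : PeriodPair) (U : Set ℂ) (lg : Fin 3 → ℂ → ℂ) (α : Fin 4 → ℂ) (d : ℕ) :
    Module.Finite ℂ (V P U lg α d) :=
  FiniteDimensional.span_of_finite ℂ (Set.finite_range _)

/-- The operator `(1 / ℘') d/dx` on functions on `U`. -/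
def ddz (P : PeriodPair) {U : Set ℂ} (f : U → ℂ) : U → ℂ := fun x =>
  1 / P.derivWeierstrassP x * ddx f x

/-- With `Φ = (℘ - e₁)^{α₁/2} (℘ - e₂)^{α₂/2} (℘ - e₃)^{α₃/2}`, the monic differential operator
`L_{α₀,α₁,α₂,α₃} = ℘'^{d+1} Φ ∘ ((1 / ℘') d/dx)^{d+1} ∘ Φ⁻¹` of order `d + 1`. -/
def darboux (P : PeriodPair) {U : Set ℂ} (lg : Fin 3 → ℂ → ℂ) (α : Fin 4 → ℂ) (d : ℕ)
    (f : U → ℂ) : U → ℂ := fun x =>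
  P.derivWeierstrassP x ^ (d + 1) * gauge U lg α x *
    (ddz P)^[d + 1] (fun y => (gauge U lg α y)⁻¹ * f y) x

end

end HeunDarboux

/-! ### Values and translates of `℘` at the half periods. -/

namespace HeunDarboux

open Filter Topology PeriodPair

/-! Put `w = ℘'`, `t = ℘ - e₁` and `D = (1/℘') d/dx`, so that `D t = 1`. If `γᵢ(γᵢ - 1) = lᵢ(lᵢ +
1)` and `Φ` has the logarithmic derivative of `∏ (℘ - e_k)^{γ_k/2}`, conjugating `H^l` by `Φ` gives
an operator `heunOp` with exponents `γ`. Its coefficients at `D²`, `D`, `1` are polynomials in `t`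
of degree at most 3, 2, 1 (`hamiltonian_mul`). This rests on the formula for `℘(x + ω_k)` and on
`℘'² = 4 ∏ (℘ - e_k)`.

For (i), let `β = -α - d`. Conjugation by `Φ_β` turns `H^{α+d}` into `heunOp` with exponents `β`.
The outer factor `w^{d+1} Φ_β` of `L_β` behaves like a gauge with exponents `β + d + 1 = 1 - α`, and
so turns `H^l` into `heunOp` with exponents `1 - α`. It remains to intertwine these two operators by
`D^{d+1}` (`heunOp_iterate`). By the Leibniz rule the only obstruction is a constant multiple of
`D^d`, which vanishes because `d = -∑ αᵢ/2`.

For (ii), in the basis `Φ_γ tⁿ` the Hamiltonian is tridiagonal, since the cubic coefficient of `D²`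
has no constant term in `t`. The condition on `d` kills the term that would leave degree `d`
(`heunUp_self`). After reversing one basis, the two matrices have equal diagonals and equal products
of opposite off-diagonal entries, hence equal characteristic polynomials (`charpoly_heunMatrix`).
This argument is independent of (i). -/

/-- `℘` takes no value infinitely often near a point outside the lattice. -/
lemma frequently_weierstrassP_ne (P : PeriodPair) {w : ℂ} (hw : w ∉ P.lattice) (c : ℂ) :
    ¬ ∃ᶠ z in 𝓝[≠] w, P.weierstrassP z = c := by
  intro h
  have hconn : IsPreconnected ((P.lattice : Set ℂ)ᶜ) := by
    have hc : (P.lattice : Set ℂ).Countable := by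
      have : Countable P.lattice := P.latticeEquivProd.toEquiv.countable_iff.mpr inferInstance
      exact this
    exact (hc.isPathConnected_compl_of_one_lt_rank
      (by simp [Complex.rank_real_complex])).isConnected.isPreconnected
  have h1 := P.analyticOnNhd_weierstrassP.eqOn_of_preconnected_of_frequently_eq
    (analyticOnNhd_const (v := c)) hconn hw h
  have h2 : meromorphicOrderAt P.weierstrassP 0 = meromorphicOrderAt (fun _ : ℂ => c) 0 := by
    apply meromorphicOrderAt_congr
    filter_upwards [self_mem_nhdsWithin, mem_nhdsWithin_of_mem_nhds
      (P.compl_lattice_sdiff_singleton_mem_nhds 0)] with z hz hz'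
    exact h1 (by simp_all)
  rw [P.order_weierstrassP 0 (zero_mem _)] at h2
  have h3 : 0 ≤ meromorphicOrderAt (fun _ : ℂ => c) 0 := analyticAt_const.meromorphicOrderAt_nonneg
  rw [← h2] at h3
  exact absurd h3 (by decide)

/-- Periodicity and oddness give `℘'(w) = ℘'(-w) = -℘'(w)`. -/
lemma derivWeierstrassP_eq_zero (P : PeriodPair) {w : ℂ} (h2 : 2 * w ∈ P.lattice) :
    P.derivWeierstrassP w = 0 := by
  have h := P.derivWeierstrassP_add_coe (-w) ⟨2 * w, h2⟩
  rw [show -w + ((⟨2 * w, h2⟩ : P.lattice) : ℂ) = w by simp; ring, P.derivWeierstrassP_neg] at h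
  exact CharZero.eq_neg_self_iff.mp h

lemma exists_eq_sq_mul_weierstrassP (P : PeriodPair) {w : ℂ} (hw : w ∉ P.lattice)
    (h2 : 2 * w ∈ P.lattice) :
    ∃ g : ℂ → ℂ, AnalyticAt ℂ g 0 ∧
      ∀ᶠ z in 𝓝 0, P.weierstrassP (z + w) - P.weierstrassP w = z ^ 2 * g z := by
  have hP : AnalyticAt ℂ P.weierstrassP (0 + w) := by
    simpa using P.analyticOnNhd_weierstrassP w hw
  have hf : AnalyticAt ℂ (fun z => P.weierstrassP (z + w) - P.weierstrassP w) 0 :=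
    (hP.comp (f := fun z => z + w) (by fun_prop)).sub analyticAt_const
  have : ((2 : ℕ) : ℕ∞) ≤
      analyticOrderAt (fun z => P.weierstrassP (z + w) - P.weierstrassP w) 0 := by
    rw [natCast_le_analyticOrderAt_iff_iteratedDeriv_eq_zero hf]
    intro i hi
    obtain rfl | rfl : i = 0 ∨ i = 1 := by omega
    · simp
    · rw [iteratedDeriv_one, deriv_sub_const, deriv_comp_add_const, P.deriv_weierstrassP, zero_add]
      exact derivWeierstrassP_eq_zero P h2
  rw [natCast_le_analyticOrderAt hf] at this
  simpa using this

open Classical in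
/-- The product of `℘ - ℘(w)` and its translate by the half period `w` is constant. -/
lemma exists_weierstrassP_add_mul_eq (P : PeriodPair) {w : ℂ} (hw : w ∉ P.lattice)
    (h2 : 2 * w ∈ P.lattice) :
    ∃ c : ℂ, ∀ z, z ∉ P.lattice → z + w ∉ P.lattice →
      (P.weierstrassP (z + w) - P.weierstrassP w) * (P.weierstrassP z - P.weierstrassP w) = c := by
  obtain ⟨g, hg, hgz⟩ := exists_eq_sq_mul_weierstrassP P hw h2
  -- The double zero of one factor cancels the double pole of the other. The filled-in value `g 0`
  -- is the limit of `z² g(z) · z⁻²` at `0`.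
  set H : ℂ → ℂ := fun z => if z ∈ P.lattice ∨ z + w ∈ P.lattice then g 0 else
    (P.weierstrassP (z + w) - P.weierstrassP w) * (P.weierstrassP z - P.weierstrassP w) with hH
  have hmem (z u : ℂ) (hu : u ∈ P.lattice) : z + u ∈ P.lattice ↔ z ∈ P.lattice :=
    P.lattice.toAddSubgroup.add_mem_cancel_right hu
  have hper (z u : ℂ) (hu : u ∈ P.lattice) : H (z + u) = H z := by
    have e1 := P.weierstrassP_add_coe z ⟨u, hu⟩
    have e2 := P.weierstrassP_add_coe (z + w) ⟨u, hu⟩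
    simp only [hH, add_right_comm z u w, hmem _ u hu]
    simp only at e1 e2
    rw [e1, e2]
  -- Translation by `w` swaps the two factors, so analyticity at lattice points carries over to the
  -- points congruent to `w`.
  have hper' (z : ℂ) : H (z + w) = H z := by
    have e2 := P.weierstrassP_add_coe z ⟨2 * w, h2⟩
    simp only at e2
    have e3 : z + w + w = z + 2 * w := by ring
    simp only [hH, e3, hmem _ _ h2, e2]
    by_cases z1 : z ∈ P.lattice <;> by_cases z2 : z + w ∈ P.lattice <;> simp [z1, z2, mul_comm]
  have h0 : AnalyticAt ℂ H 0 := by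
    have hE := P.analyticAt_weierstrassPExcept 0
    have : AnalyticAt ℂ (fun z => g z *
        (z ^ 2 * (P.weierstrassPExcept 0 z - P.weierstrassP w) + 1)) 0 := by
      fun_prop
    apply this.congr
    have hcont : ∀ᶠ z in 𝓝 (0 : ℂ), z + w ∉ P.lattice := by
      have : Tendsto (fun z : ℂ => z + w) (𝓝 0) (𝓝 w) := by
        have : Continuous fun z : ℂ => z + w := by fun_prop
        simpa using this.tendsto 0
      exact this.eventually (P.isClosed_lattice.isOpen_compl.mem_nhds hw)
    filter_upwards [hgz, P.compl_lattice_sdiff_singleton_mem_nhds 0, hcont] with z h1 h3 h4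
    by_cases hz : z = 0
    · simp [hH, hz]
    · have hzL : z ∉ P.lattice := by simp_all
      have := P.weierstrassPExcept_add 0 z
      simp only [hH, hzL, h4, or_self, if_false, h1, ← this]
      simp
      field_simp
      ring
  have han : Differentiable ℂ H := by
    have key (x : ℂ) (hx : x ∈ P.lattice) : AnalyticAt ℂ H x := by
      have h1 : AnalyticAt ℂ (H ∘ fun z => z - x) x := by
        apply AnalyticAt.comp
        · simpa using h0
        · fun_prop
      convert h1 using 1
      ext z
      simp only [Function.comp]
      rw [← hper (z - x) x hx, sub_add_cancel]
    intro x
    by_cases hx : x ∈ P.lattice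
    · exact (key x hx).differentiableAt
    by_cases hx' : x + w ∈ P.lattice
    · have h1 : AnalyticAt ℂ (H ∘ fun z => z + w) x := by
        apply AnalyticAt.comp
        · exact key _ hx'
        · fun_prop
      rw [show H = H ∘ fun z => z + w from funext fun z => (hper' z).symm]
      exact h1.differentiableAt
    · have o1 : ∀ᶠ z in 𝓝 x, z ∉ P.lattice := P.isClosed_lattice.isOpen_compl.mem_nhds hx
      have o2 : ∀ᶠ z in 𝓝 x, z + w ∉ P.lattice :=
        (by fun_prop : Continuous fun z : ℂ => z + w).continuousAt.eventually
          (P.isClosed_lattice.isOpen_compl.mem_nhds hx')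
      have a1 := P.analyticOnNhd_weierstrassP x hx
      have a2 := P.analyticOnNhd_weierstrassP (x + w) hx'
      have a3 : AnalyticAt ℂ (fun z => P.weierstrassP (z + w)) x :=
        a2.comp (f := fun z => z + w) (by fun_prop)
      refine DifferentiableAt.congr_of_eventuallyEq (f := fun z =>
        (P.weierstrassP (z + w) - P.weierstrassP w) * (P.weierstrassP z - P.weierstrassP w)) ?_ ?_
      · exact ((a3.sub analyticAt_const).mul (a1.sub analyticAt_const)).differentiableAt
      · filter_upwards [o1, o2] with z z1 z2
        simp [hH, z1, z2]
  refine ⟨H 0, fun z z1 z2 => ?_⟩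
  -- Liouville: an entire doubly periodic function is bounded, hence constant.
  have := han.apply_eq_apply_of_bounded (IsZLattice.isCompact_range_of_periodic P.lattice _
    han.continuous fun z u hu => hper z u hu).isBounded z 0
  rw [← this]
  simp [hH, z1, z2]

/-- `℘` takes its value at a half period `w` only at the points congruent to `w`. -/
lemma weierstrassP_ne_of_ne (P : PeriodPair) {w z : ℂ} (hw : w ∉ P.lattice)
    (h2 : 2 * w ∈ P.lattice) (hz : z ∉ P.lattice) (hzw : z + w ∉ P.lattice) :
    P.weierstrassP z ≠ P.weierstrassP w := by
  intro heq
  obtain ⟨c, hc⟩ := exists_weierstrassP_add_mul_eq P hw h2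
  obtain rfl : 0 = c := by rw [← hc z hz hzw, heq, sub_self, mul_zero]
  have hf := frequently_weierstrassP_ne P hw (P.weierstrassP w)
  rw [not_frequently] at hf
  have o1 : ∀ᶠ z in 𝓝 w, z ∉ P.lattice := P.isClosed_lattice.isOpen_compl.mem_nhds hw
  have o2 : ∀ᶠ z in 𝓝[≠] w, z + w ∉ P.lattice := by
    have := P.compl_lattice_sdiff_singleton_mem_nhds (w + w)
    have := (by fun_prop : Continuous fun z : ℂ => z + w).continuousAt (x := w) this
    filter_upwards [self_mem_nhdsWithin, mem_nhdsWithin_of_mem_nhds this] with z h1 h3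
    simp_all
  have t : Tendsto (fun z : ℂ => z + w) (𝓝[≠] w) (𝓝[≠] (2 * w)) := by
    refine tendsto_nhdsWithin_iff.mpr ⟨?_, ?_⟩
    · have : Continuous fun z : ℂ => z + w := by fun_prop
      have := this.tendsto w
      rw [← two_mul] at this
      exact this.mono_left nhdsWithin_le_nhds
    · filter_upwards [self_mem_nhdsWithin] with z hz h
      simp only [Set.mem_singleton_iff, two_mul, add_left_inj] at h
      exact hz h
  -- The constant product is now `0`. Near `w`, however, `℘(z) ≠ ℘(w)`, and `℘(z + w)` is large
  -- because `2w` is a pole, so neither factor vanishes.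
  have hinf := tendsto_cobounded_of_meromorphicOrderAt_neg (f := P.weierstrassP) (x := 2 * w)
    (by rw [P.order_weierstrassP _ h2]; decide)
  have hne := (hinf.comp t).eventually (Bornology.eventually_ne_cobounded (P.weierstrassP w))
  obtain ⟨u, hu1, hu2, hu3, hu4⟩ :=
    (hf.and ((o1.filter_mono nhdsWithin_le_nhds).and (o2.and hne))).exists
  rcases mul_eq_zero.mp (hc u hu2 hu3) with h | h
  · exact hu4 (sub_eq_zero.mp h)
  · exact hu1 (sub_eq_zero.mp h)

lemma two_mul_halfPeriod_mem (P : PeriodPair) (i : Fin 4) : 2 * halfPeriod P i ∈ P.lattice := by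
  have h1 := P.ω₁_mem_lattice
  have h2 := P.ω₂_mem_lattice
  fin_cases i
  · simp [halfPeriod]
  · convert h1 using 1
    simp [halfPeriod]
    ring
  · convert neg_mem (add_mem h1 h2) using 1
    simp [halfPeriod]
    ring
  · convert h2 using 1
    simp [halfPeriod]
    ring

lemma halfPeriod_succ_notMem (P : PeriodPair) (i : Fin 3) :
    halfPeriod P i.succ ∉ P.lattice := by
  fin_cases i
  · simpa [halfPeriod] using P.ω₁_div_two_notMem_lattice
  · have := (P.mul_ω₁_add_mul_ω₂_mem_lattice (α := -1 / 2) (β := -1 / 2)).not.mpr (by norm_num)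
    convert this using 2
    simp [halfPeriod]
    ring
  · simpa [halfPeriod] using P.ω₂_div_two_notMem_lattice

lemma halfPeriod_add_add (P : PeriodPair) {i j k : Fin 3} (hij : i ≠ j) (hik : i ≠ k)
    (hjk : j ≠ k) : halfPeriod P j.succ + halfPeriod P i.succ = -halfPeriod P k.succ := by
  fin_cases i <;> fin_cases j <;> fin_cases k <;>
    first | contradiction | (simp [halfPeriod]; try ring)

lemma exists_third (i j : Fin 3) (hij : i ≠ j) : ∃ k, i ≠ k ∧ j ≠ k := by
  revert i j; decide

lemma e_injective (P : PeriodPair) : Function.Injective (e P) := by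
  intro i j h
  by_contra hij
  obtain ⟨k, hik, hjk⟩ := exists_third i j hij
  refine weierstrassP_ne_of_ne P (halfPeriod_succ_notMem P j) (two_mul_halfPeriod_mem P _)
    (halfPeriod_succ_notMem P i) ?_ h
  rw [halfPeriod_add_add P (Ne.symm hij) hjk hik, neg_mem_iff]
  exact halfPeriod_succ_notMem P k

/-- Translation of `℘` by a half period. -/
lemma weierstrassP_add_halfPeriod (P : PeriodPair) {i j k : Fin 3} (hij : i ≠ j) (hik : i ≠ k)
    (hjk : j ≠ k) {z : ℂ} (hz : 2 * z ∉ P.lattice) (hne : P.weierstrassP z - e P i ≠ 0) :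
    P.weierstrassP (z + halfPeriod P i.succ) =
      e P i + (e P i - e P j) * (e P i - e P k) / (P.weierstrassP z - e P i) := by
  obtain ⟨c, hc⟩ := exists_weierstrassP_add_mul_eq P (halfPeriod_succ_notMem P i)
    (two_mul_halfPeriod_mem P _)
  -- The constant is found at `z = ω_j`, where `ω_j + ω_i = -ω_k`: it equals `(e_k - e_i)(e_j -
  -- e_i)`.
  have h1 := hc (halfPeriod P j.succ) (halfPeriod_succ_notMem P j) (by
    rw [halfPeriod_add_add P hij hik hjk, neg_mem_iff]
    exact halfPeriod_succ_notMem P k)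
  have h2 := hc z (fun h => hz (by simpa [two_mul] using add_mem h h)) (fun h => hz (by
    have := sub_mem (add_mem h h) (two_mul_halfPeriod_mem P i.succ)
    convert this using 1
    ring))
  rw [halfPeriod_add_add P hij hik hjk, P.weierstrassP_neg] at h1
  change (e P k - e P i) * (e P j - e P i) = c at h1
  change (_ - e P i) * (_ - e P i) = c at h2
  rw [← sub_eq_iff_eq_add', eq_div_iff hne, h2, ← h1]
  ring

lemma e_cubic (P : PeriodPair) (i : Fin 3) : 4 * e P i ^ 3 - P.g₂ * e P i - P.g₃ = 0 := by
  have := P.derivWeierstrassP_sq _ (halfPeriod_succ_notMem P i)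
  rw [derivWeierstrassP_eq_zero P (two_mul_halfPeriod_mem P _)] at this
  rw [e, ← this]
  simp

/-- The `e_i` are three distinct roots of a cubic without quadratic term. The combination used
eliminates `g₂` and `g₃`, leaving the sum times the Vandermonde product. -/
lemma e_sum (P : PeriodPair) : e P 0 + e P 1 + e P 2 = 0 := by
  have h0 := e_cubic P 0
  have h1 := e_cubic P 1
  have h2 := e_cubic P 2
  have n01 : e P 0 - e P 1 ≠ 0 := sub_ne_zero.mpr ((e_injective P).ne (by decide))
  have n02 : e P 0 - e P 2 ≠ 0 := sub_ne_zero.mpr ((e_injective P).ne (by decide))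
  have n12 : e P 1 - e P 2 ≠ 0 := sub_ne_zero.mpr ((e_injective P).ne (by decide))
  apply mul_left_cancel₀ n01
  apply mul_left_cancel₀ n02
  apply mul_left_cancel₀ n12
  linear_combination (1 / 4) * ((e P 1 - e P 2) * h0 - (e P 0 - e P 2) * h1 +
    (e P 0 - e P 1) * h2)

lemma derivWeierstrassP_sq_eq_prod (P : PeriodPair) {z : ℂ} (hz : z ∉ P.lattice) :
    P.derivWeierstrassP z ^ 2 = 4 * (P.weierstrassP z - e P 0) * (P.weierstrassP z - e P 1) *
      (P.weierstrassP z - e P 2) := by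
  rw [P.derivWeierstrassP_sq z hz]
  have h0 := e_cubic P 0
  have h1 := e_cubic P 1
  have hs : e P 2 = -e P 0 - e P 1 := by linear_combination e_sum P
  have n01 : e P 0 - e P 1 ≠ 0 := sub_ne_zero.mpr ((e_injective P).ne (by decide))
  rw [hs]
  apply mul_left_cancel₀ n01
  linear_combination (P.weierstrassP z - e P 1) * h0 - (P.weierstrassP z - e P 0) * h1

end HeunDarboux

/-! ### The algebra of holomorphic functions on `U` and its derivation `d/dx`. -/

namespace HeunDarboux

/-- The algebra of holomorphic functions on `U`. -/
def Holo (U : Set ℂ) : Subalgebra ℂ (U → ℂ) where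
  carrier := {f | IsHolo f}
  mul_mem' {f g} hf hg := (hf.mul hg).congr fun x hx => by
    lift x to U using hx
    simp [zeroExt]
  add_mem' {f g} hf hg := (hf.add hg).congr fun x hx => by
    lift x to U using hx
    simp [zeroExt]
  algebraMap_mem' c := (differentiableOn_const c).congr fun x hx => by
    lift x to U using hx
    simp [zeroExt]

variable {U : Set ℂ}

lemma zeroExt_coe (f : U → ℂ) (x : U) : zeroExt f x = f x :=
  Subtype.val_injective.extend_apply _ _ _

lemma eqOn_zeroExt (F : ℂ → ℂ) : Set.EqOn (zeroExt fun x : U => F x) F U := fun x hx => by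
  lift x to U using hx
  exact zeroExt_coe _ x

lemma mem_holo_of_differentiableOn {F : ℂ → ℂ} (hF : DifferentiableOn ℂ F U) :
    (fun x : U => F x) ∈ Holo U :=
  hF.congr (eqOn_zeroExt F)

lemma ddx_restrict (hU : IsOpen U) (F : ℂ → ℂ) (x : U) :
    ddx (fun x : U => F x) x = deriv F x :=
  ((eqOn_zeroExt F).eventuallyEq_of_mem (hU.mem_nhds x.2)).deriv_eq

lemma ddx_mem_holo (hU : IsOpen U) (f : Holo U) : ddx (f : U → ℂ) ∈ Holo U :=
  mem_holo_of_differentiableOn (DifferentiableOn.deriv f.2 hU)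

lemma inv_mem_holo (f : Holo U) (hf : ∀ x, (f : U → ℂ) x ≠ 0) :
    (fun x => ((f : U → ℂ) x)⁻¹) ∈ Holo U := by
  refine (DifferentiableOn.inv f.2 fun x hx => ?_).congr fun x hx => ?_
  all_goals lift x to U using hx
  · rw [zeroExt_coe]
    exact hf x
  · simp [zeroExt_coe]

lemma differentiableAt_zeroExt (hU : IsOpen U) (f : Holo U) (x : U) :
    DifferentiableAt ℂ (zeroExt (f : U → ℂ)) x :=
  DifferentiableOn.differentiableAt f.2 (hU.mem_nhds x.2)

lemma ddx_eq_of_eqOn (hU : IsOpen U) {f : U → ℂ} {F : ℂ → ℂ} (h : ∀ x : U, f x = F x) (x : U) :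
    ddx f x = deriv F x := by
  rw [← ddx_restrict hU F x, funext h]

/-- Differentiation as a derivation of the algebra of holomorphic functions. -/
noncomputable def holoDeriv (hU : IsOpen U) : Derivation ℂ (Holo U) (Holo U) :=
  Derivation.mk'
    { toFun f := ⟨ddx (f : U → ℂ), ddx_mem_holo hU f⟩
      map_add' f g := by
        ext x
        have hf := differentiableAt_zeroExt hU f x
        have hg := differentiableAt_zeroExt hU g x
        have h := ddx_eq_of_eqOn hU (f := ((f + g : Holo U) : U → ℂ))
          (F := zeroExt (f : U → ℂ) + zeroExt (g : U → ℂ))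
          (fun x => by simp [zeroExt_coe]) x
        rw [deriv_add hf hg] at h
        exact h
      map_smul' c f := by
        ext x
        have h := ddx_eq_of_eqOn hU (f := ((c • f : Holo U) : U → ℂ))
          (F := c • zeroExt (f : U → ℂ)) (fun x => by simp [zeroExt_coe]) x
        rw [deriv_const_smul_field] at h
        exact h }
    fun f g => by
      ext x
      have hf := differentiableAt_zeroExt hU f x
      have hg := differentiableAt_zeroExt hU g x
      have h := ddx_eq_of_eqOn hU (f := ((f * g : Holo U) : U → ℂ))
        (F := zeroExt (f : U → ℂ) * zeroExt (g : U → ℂ))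
        (fun x => by simp [zeroExt_coe]) x
      rw [deriv_mul hf hg, zeroExt_coe, zeroExt_coe] at h
      refine h.trans ?_
      change ddx (f : U → ℂ) x * (g : U → ℂ) x + (f : U → ℂ) x * ddx (g : U → ℂ) x =
        (f : U → ℂ) x * ddx (g : U → ℂ) x + (g : U → ℂ) x * ddx (f : U → ℂ) x
      ring

@[simp] lemma coe_holoDeriv (hU : IsOpen U) (f : Holo U) :
    (holoDeriv hU f : U → ℂ) = ddx (f : U → ℂ) := rfl

/-! ### Commuting powers of a derivation past the Heun operator. -/

section Operator

variable {A : Type*} [CommRing A]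

/-- Leibniz rule for the iterates of a derivation and a second order operator whose coefficients
are polynomials of degrees `3`, `2`, `1`. -/
lemma iterate_derivation_secondOrder {R : Type*} [CommRing R] [Algebra R A]
    (D : Derivation R A A) {t : A} (ht : D t = 1) {q₃ q₂ q₁ a₂ a₁ a₀ b₁ b₀ : A}
    (hq₃ : D q₃ = 0) (hq₂ : D q₂ = 0) (hq₁ : D q₁ = 0) (ha₂ : D a₂ = 0) (ha₁ : D a₁ = 0)
    (ha₀ : D a₀ = 0) (hb₁ : D b₁ = 0) (hb₀ : D b₀ = 0) (g : A) (m : ℕ) :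
    D^[m + 1] ((q₃ * t ^ 3 + q₂ * t ^ 2 + q₁ * t) * D (D g) +
        (a₂ * t ^ 2 + a₁ * t + a₀) * D g + (b₁ * t + b₀) * g) =
      (q₃ * t ^ 3 + q₂ * t ^ 2 + q₁ * t) * D (D (D^[m + 1] g)) +
      (a₂ * t ^ 2 + a₁ * t + a₀ + (m + 1) * (3 * q₃ * t ^ 2 + 2 * q₂ * t + q₁)) *
        D (D^[m + 1] g) +
      (b₁ * t + b₀ + (m + 1) * (2 * a₂ * t + a₁) + (m + 1) * m * (3 * q₃ * t + q₂)) *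
        D^[m + 1] g +
      ((m + 1) * b₁ + (m + 1) * m * a₂ + (m + 1) * m * (m - 1) * q₃) * D^[m] g := by
  induction m with
  | zero =>
    simp [ht, hq₃, hq₂, hq₁, ha₂, ha₁, ha₀, hb₁, hb₀, D.leibniz, D.leibniz_pow]
    ring
  | succ m ih =>
    rw [Function.iterate_succ_apply', ih]
    simp only [Function.iterate_succ_apply' D]
    have h2 : D 2 = 0 := D.map_natCast 2
    have h3 : D 3 = 0 := D.map_natCast 3
    simp [h2, h3, ht, hq₃, hq₂, hq₁, ha₂, ha₁, ha₀, hb₁, hb₀, D.leibniz, D.leibniz_pow]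
    ring

variable [Algebra ℂ A]

/-- The operator obtained from the Hamiltonian by a gauge transformation with exponents `γ` and the
change of variables `t = ℘ - e₁`. -/
def heunOp (D : Derivation ℂ A A) (t : A) (e : Fin 3 → ℂ) (γ : Fin 4 → ℂ) (g : A) : A :=
  -((algebraMap ℂ A 4 * t ^ 3 + algebraMap ℂ A (-4 * (e 1 - e 0 + (e 2 - e 0))) * t ^ 2 +
      algebraMap ℂ A (4 * (e 1 - e 0) * (e 2 - e 0)) * t) * D (D g) +
    (algebraMap ℂ A (6 + 4 * (γ 1 + γ 2 + γ 3)) * t ^ 2 +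
      algebraMap ℂ A (-4 * (1 + γ 1) * (e 1 - e 0 + (e 2 - e 0)) -
        4 * (γ 2 * (e 2 - e 0) + γ 3 * (e 1 - e 0))) * t +
      algebraMap ℂ A ((2 + 4 * γ 1) * (e 1 - e 0) * (e 2 - e 0))) * D g +
    (algebraMap ℂ A ((γ 1 + γ 2 + γ 3) * (γ 1 + γ 2 + γ 3 + 1) - γ 0 * (γ 0 - 1)) * t +
      algebraMap ℂ A (e 0 * ((γ 1 + γ 2 + γ 3) * (γ 1 + γ 2 + γ 3 + 1) - γ 0 * (γ 0 - 1)) +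
        γ 1 ^ 2 * e 0 + γ 2 ^ 2 * e 1 + γ 3 ^ 2 * e 2 -
        2 * (γ 2 * γ 3 * e 0 + γ 1 * γ 3 * e 1 + γ 1 * γ 2 * e 2))) * g)

/-- Moving `D^{d+1}` to the right raises every exponent by `d + 1`, from `-α - d` to `1 - α`, apart
from a remainder proportional to `D^d g`. -/
lemma heunOp_iterate (D : Derivation ℂ A A) {t : A} (ht : D t = 1) {e : Fin 3 → ℂ}
    (he : e 0 + e 1 + e 2 = 0) {α : Fin 4 → ℂ} {d : ℕ} (hd : (d : ℂ) = -∑ i, α i / 2) (g : A) :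
    heunOp D t e (fun i => 1 - α i) (D^[d + 1] g) =
      D^[d + 1] (heunOp D t e (fun i => -α i - d) g) := by
  have h0 : α 0 = -2 * d - α 1 - α 2 - α 3 := by
    rw [Fin.sum_univ_four] at hd
    linear_combination 2 * hd
  have h2 : e 2 = -e 0 - e 1 := by linear_combination he
  have hc : (d : A) = algebraMap ℂ A d := by simp
  simp only [heunOp, iterate_map_neg]
  rw [iterate_derivation_secondOrder D ht]
  any_goals exact D.map_algebraMap _
  rw [hc, ← sub_eq_zero]
  -- The coefficient of the remainder. Up to the factor `d + 1` it is the amount by which the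
  -- operator raises `t^d` to `t^{d+1}`, and `hd` makes it zero.
  have hK : (algebraMap ℂ A d + 1) * algebraMap ℂ A ((-α 1 - d + (-α 2 - d) + (-α 3 - d)) *
      (-α 1 - d + (-α 2 - d) + (-α 3 - d) + 1) - (-α 0 - d) * (-α 0 - d - 1)) +
      (algebraMap ℂ A d + 1) * algebraMap ℂ A d *
        algebraMap ℂ A (6 + 4 * (-α 1 - d + (-α 2 - d) + (-α 3 - d))) +
      (algebraMap ℂ A d + 1) * algebraMap ℂ A d * (algebraMap ℂ A d - 1) * algebraMap ℂ A 4 = 0 := by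
    simp only [← map_one (algebraMap ℂ A), ← map_add, ← map_mul, ← map_sub]
    rw [← map_zero (algebraMap ℂ A)]
    congr 1
    rw [h0]
    ring
  rw [hK, h0, h2]
  simp only [map_add, map_mul, map_sub, map_neg, map_one, map_pow, map_ofNat]
  ring

end Operator

end HeunDarboux

/-! ### Gauge transformation of the Hamiltonian. -/

namespace HeunDarboux

section Gauge

variable {A : Type*} [CommRing A] [Algebra ℂ A]

/-- To be used with `δ = d/dx`, `D = d/d℘`, `w = ℘'`, and `φ` the logarithmic derivative of the
gauge factor `Φ`. -/
lemma derivation_derivation_mul {δ D : Derivation ℂ A A} {w : A} (hδ : ∀ f, δ f = w * D f)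
    {Φ φ : A} (hΦ : D Φ = φ * Φ) (g : A) :
    δ (δ (Φ * g)) = Φ * (w ^ 2 * D (D g) + (w * D w + 2 * w ^ 2 * φ) * D g +
      (w ^ 2 * (φ ^ 2 + D φ) + w * D w * φ) * g) := by
  simp [hδ, D.leibniz, hΦ]
  ring

end Gauge

/-- Evaluation at a point of `U`. -/
def evalHolo {U : Set ℂ} (x : U) : Holo U →ₐ[ℂ] ℂ := (Pi.evalAlgHom ℂ _ x).comp (Holo U).val

lemma evalHolo_algebraMap {U : Set ℂ} (x : U) (c : ℂ) :
    evalHolo x (algebraMap ℂ (Holo U) c) = c := rfl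

/-- An open set that contains no half period. -/
structure IsRegularDomain (P : PeriodPair) (U : Set ℂ) : Prop where
  isOpen : IsOpen U
  two_mul_notMem : ∀ x ∈ U, 2 * x ∉ P.lattice

namespace IsRegularDomain

variable {P : PeriodPair} {U : Set ℂ}

lemma notMem (hU : IsRegularDomain P U) (x : U) : (x : ℂ) ∉ P.lattice := fun h =>
  hU.two_mul_notMem x x.2 (by simpa [two_mul] using add_mem h h)

lemma sub_ne_zero (hU : IsRegularDomain P U) (x : U) (i : Fin 3) :
    P.weierstrassP x - e P i ≠ 0 :=
  _root_.sub_ne_zero.mpr <| weierstrassP_ne_of_ne P (halfPeriod_succ_notMem P i)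
    (two_mul_halfPeriod_mem P _) (hU.notMem x) fun h => hU.two_mul_notMem x x.2 (by
      have := sub_mem (add_mem h h) (two_mul_halfPeriod_mem P i.succ)
      convert this using 1
      ring)

lemma derivWeierstrassP_ne_zero (hU : IsRegularDomain P U) (x : U) :
    P.derivWeierstrassP x ≠ 0 := by
  have h := derivWeierstrassP_sq_eq_prod P (hU.notMem x)
  have h0 := hU.sub_ne_zero x 0
  have h1 := hU.sub_ne_zero x 1
  have h2 := hU.sub_ne_zero x 2
  intro hz
  rw [hz] at h
  have : 4 * (P.weierstrassP x - e P 0) * (P.weierstrassP x - e P 1) *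
      (P.weierstrassP x - e P 2) ≠ 0 :=
    mul_ne_zero (mul_ne_zero (mul_ne_zero (by norm_num) h0) h1) h2
  exact this (by rw [← h]; ring)

/-- `℘` as a holomorphic function on `U`. -/
noncomputable def p (hU : IsRegularDomain P U) : Holo U :=
  ⟨fun x => P.weierstrassP x, mem_holo_of_differentiableOn <|
    P.differentiableOn_weierstrassP.mono fun x hx => hU.notMem ⟨x, hx⟩⟩

/-- `℘'` as a holomorphic function on `U`. -/
noncomputable def w (hU : IsRegularDomain P U) : Holo U :=
  ⟨fun x => P.derivWeierstrassP x, mem_holo_of_differentiableOn <|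
    P.differentiableOn_derivWeierstrassP.mono fun x hx => hU.notMem ⟨x, hx⟩⟩

/-- `1 / ℘'` as a holomorphic function on `U`. -/
noncomputable def wInv (hU : IsRegularDomain P U) : Holo U :=
  ⟨_, inv_mem_holo hU.w hU.derivWeierstrassP_ne_zero⟩

/-- `1 / (℘ - e_k)` as a holomorphic function on `U`. -/
noncomputable def r (hU : IsRegularDomain P U) (i : Fin 3) : Holo U :=
  ⟨_, inv_mem_holo (hU.p - algebraMap ℂ _ (e P i)) fun x => hU.sub_ne_zero x i⟩

/-- `(1 / ℘') d/dx` as a derivation. -/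
noncomputable def D (hU : IsRegularDomain P U) : Derivation ℂ (Holo U) (Holo U) :=
  hU.wInv • holoDeriv hU.isOpen

lemma w_mul_wInv (hU : IsRegularDomain P U) : hU.w * hU.wInv = 1 := by
  ext x
  exact mul_inv_cancel₀ (hU.derivWeierstrassP_ne_zero x)

lemma holoDeriv_eq (hU : IsRegularDomain P U) (f : Holo U) :
    holoDeriv hU.isOpen f = hU.w * hU.D f := by
  simp [D, ← mul_assoc, hU.w_mul_wInv]

lemma coe_D (hU : IsRegularDomain P U) (f : Holo U) :
    (hU.D f : U → ℂ) = ddz P (f : U → ℂ) := by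
  ext x
  simp [D, ddz, wInv, w]

lemma coe_D_iterate (hU : IsRegularDomain P U) (f : Holo U) (n : ℕ) :
    (hU.D^[n] f : U → ℂ) = (ddz P)^[n] (f : U → ℂ) := by
  induction n with
  | zero => rfl
  | succ n ih => rw [Function.iterate_succ_apply', Function.iterate_succ_apply', coe_D, ih]

lemma evalHolo_p (hU : IsRegularDomain P U) (x : U) : evalHolo x hU.p = P.weierstrassP x := rfl

lemma evalHolo_r (hU : IsRegularDomain P U) (x : U) (i : Fin 3) :
    evalHolo x (hU.r i) = (P.weierstrassP x - e P i)⁻¹ := rfl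

lemma holoDeriv_p (hU : IsRegularDomain P U) : holoDeriv hU.isOpen hU.p = hU.w := by
  ext x
  exact (ddx_restrict hU.isOpen P.weierstrassP x).trans (by rw [P.deriv_weierstrassP]; rfl)

lemma D_p (hU : IsRegularDomain P U) : hU.D hU.p = 1 := by
  simp only [D, Derivation.smul_apply, holoDeriv_p, smul_eq_mul]
  rw [mul_comm, w_mul_wInv]

lemma r_mul (hU : IsRegularDomain P U) (i : Fin 3) :
    hU.r i * (hU.p - algebraMap ℂ _ (e P i)) = 1 := by
  ext x
  exact inv_mul_cancel₀ (hU.sub_ne_zero x i)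

lemma D_r (hU : IsRegularDomain P U) (i : Fin 3) : hU.D (hU.r i) = -hU.r i ^ 2 := by
  have h := congr_arg hU.D (hU.r_mul i)
  have h1 := hU.r_mul i
  simp only [Derivation.leibniz, map_sub, D_p, Derivation.map_algebraMap, smul_eq_mul,
    Derivation.map_one_eq_zero] at h
  linear_combination hU.r i * h - hU.D (hU.r i) * h1

lemma w_sq (hU : IsRegularDomain P U) : hU.w ^ 2 = 4 * (hU.p - algebraMap ℂ _ (e P 0)) *
    (hU.p - algebraMap ℂ _ (e P 1)) * (hU.p - algebraMap ℂ _ (e P 2)) := by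
  ext x
  exact derivWeierstrassP_sq_eq_prod P (hU.notMem x)

lemma w_mul_D_w (hU : IsRegularDomain P U) : hU.w * hU.D hU.w =
    2 * ((hU.p - algebraMap ℂ _ (e P 1)) * (hU.p - algebraMap ℂ _ (e P 2)) +
      (hU.p - algebraMap ℂ _ (e P 0)) * (hU.p - algebraMap ℂ _ (e P 2)) +
      (hU.p - algebraMap ℂ _ (e P 0)) * (hU.p - algebraMap ℂ _ (e P 1))) := by
  have h := congr_arg hU.D hU.w_sq
  have h4 : hU.D 4 = 0 := hU.D.map_natCast 4
  simp only [Derivation.leibniz, Derivation.leibniz_pow, map_sub, D_p, Derivation.map_algebraMap,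
    smul_eq_mul, h4, nsmul_eq_mul] at h
  have h2 : (algebraMap ℂ (Holo U) (1 / 2)) * 2 = 1 := by
    rw [← map_ofNat (algebraMap ℂ (Holo U)), ← map_mul]
    norm_num
  push_cast at h
  linear_combination algebraMap ℂ (Holo U) (1 / 2) * h + (2 * ((hU.p - algebraMap ℂ _ (e P 1)) *
    (hU.p - algebraMap ℂ _ (e P 2)) + (hU.p - algebraMap ℂ _ (e P 0)) *
    (hU.p - algebraMap ℂ _ (e P 2)) + (hU.p - algebraMap ℂ _ (e P 0)) *
    (hU.p - algebraMap ℂ _ (e P 1))) - hU.w * hU.D hU.w) * h2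

/-- The logarithmic derivative, with respect to `℘`, of `∏ (℘ - e_k)^{γ_k/2}`. -/
noncomputable def logD (hU : IsRegularDomain P U) (γ : Fin 4 → ℂ) : Holo U :=
  ∑ i : Fin 3, (γ i.succ / 2) • hU.r i

lemma sum_weierstrassP_add_halfPeriod (hU : IsRegularDomain P U) (l : Fin 4 → ℂ) (x : U) :
    ∑ i, l i * (l i + 1) * P.weierstrassP ((x : ℂ) + halfPeriod P i) =
      l 0 * (l 0 + 1) * P.weierstrassP x +
      l 1 * (l 1 + 1) * (e P 0 + (e P 0 - e P 1) * (e P 0 - e P 2) / (P.weierstrassP x - e P 0)) +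
      l 2 * (l 2 + 1) * (e P 1 + (e P 1 - e P 0) * (e P 1 - e P 2) / (P.weierstrassP x - e P 1)) +
      l 3 * (l 3 + 1) * (e P 2 + (e P 2 - e P 0) * (e P 2 - e P 1) / (P.weierstrassP x - e P 2))
      := by
  have h0 := weierstrassP_add_halfPeriod P (i := 0) (j := 1) (k := 2) (by decide) (by decide)
    (by decide) (hU.two_mul_notMem x x.2) (hU.sub_ne_zero x 0)
  have h1 := weierstrassP_add_halfPeriod P (i := 1) (j := 0) (k := 2) (by decide) (by decide)
    (by decide) (hU.two_mul_notMem x x.2) (hU.sub_ne_zero x 1)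
  have h2 := weierstrassP_add_halfPeriod P (i := 2) (j := 0) (k := 1) (by decide) (by decide)
    (by decide) (hU.two_mul_notMem x x.2) (hU.sub_ne_zero x 2)
  rw [← h0, ← h1, ← h2, Fin.sum_univ_four]
  simp [halfPeriod]

/-- The residual identity behind the gauge transformation of the potential. -/
lemma potential_identity {e₀ e₁ e₂ z : ℂ} (he : e₀ + e₁ + e₂ = 0) (h0 : z - e₀ ≠ 0)
    (h1 : z - e₁ ≠ 0) (h2 : z - e₂ ≠ 0) (γ₀ γ₁ γ₂ γ₃ : ℂ) :
    4 * (z - e₀) * (z - e₁) * (z - e₂) *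
      ((γ₁ / 2 * (z - e₀)⁻¹ + γ₂ / 2 * (z - e₁)⁻¹ + γ₃ / 2 * (z - e₂)⁻¹) ^ 2 +
        (γ₁ / 2 * -(z - e₀)⁻¹ ^ 2 + γ₂ / 2 * -(z - e₁)⁻¹ ^ 2 + γ₃ / 2 * -(z - e₂)⁻¹ ^ 2)) +
      2 * ((z - e₁) * (z - e₂) + (z - e₀) * (z - e₂) + (z - e₀) * (z - e₁)) *
        (γ₁ / 2 * (z - e₀)⁻¹ + γ₂ / 2 * (z - e₁)⁻¹ + γ₃ / 2 * (z - e₂)⁻¹) -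
      (γ₀ * (γ₀ - 1) * z +
        γ₁ * (γ₁ - 1) * (e₀ + (e₀ - e₁) * (e₀ - e₂) / (z - e₀)) +
        γ₂ * (γ₂ - 1) * (e₁ + (e₁ - e₀) * (e₁ - e₂) / (z - e₁)) +
        γ₃ * (γ₃ - 1) * (e₂ + (e₂ - e₀) * (e₂ - e₁) / (z - e₂))) =
    ((γ₁ + γ₂ + γ₃) * (γ₁ + γ₂ + γ₃ + 1) - γ₀ * (γ₀ - 1)) * (z - e₀) +
      (e₀ * ((γ₁ + γ₂ + γ₃) * (γ₁ + γ₂ + γ₃ + 1) - γ₀ * (γ₀ - 1)) +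
        γ₁ ^ 2 * e₀ + γ₂ ^ 2 * e₁ + γ₃ ^ 2 * e₂ -
        2 * (γ₂ * γ₃ * e₀ + γ₁ * γ₃ * e₁ + γ₁ * γ₂ * e₂)) := by
  -- Both groups of terms have at most a simple pole at `z = e_k`, with the same residue `γ(γ - 1) ∏
  -- (e_k - e_j)` for the exponent `γ` at `e_k`, so their difference is a polynomial in `z`.
  obtain rfl : e₂ = -e₀ - e₁ := by linear_combination he
  field_simp
  ring

/-- The Hamiltonian is conjugate to a differential operator with polynomial coefficients. -/
lemma hamiltonian_mul (hU : IsRegularDomain P U) {l γ : Fin 4 → ℂ}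
    (hl : ∀ i, l i * (l i + 1) = γ i * (γ i - 1)) {Φ : Holo U} (hΦ : hU.D Φ = hU.logD γ * Φ)
    (g : Holo U) :
    hamiltonian P l ((Φ * g : Holo U) : U → ℂ) =
      ((Φ * heunOp hU.D (hU.p - algebraMap ℂ _ (e P 0)) (e P) γ g : Holo U) : U → ℂ) := by
  have h := derivation_derivation_mul hU.holoDeriv_eq hΦ g
  have hφ : hU.D (hU.logD γ) = ∑ i : Fin 3, (γ i.succ / 2) • -hU.r i ^ 2 := by
    simp [logD, D_r]
  rw [hφ, w_mul_D_w, w_sq] at h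
  ext x
  have h0 := hU.sub_ne_zero x 0
  have h1 := hU.sub_ne_zero x 1
  have h2 := hU.sub_ne_zero x 2
  have hid := potential_identity (e_sum P) h0 h1 h2 (γ 0) (γ 1) (γ 2) (γ 3)
  have hx := congr_arg (evalHolo x) h
  rw [hamiltonian, sum_weierstrassP_add_halfPeriod hU, hl, hl, hl, hl]
  change ddx (ddx ((Φ * g : Holo U) : U → ℂ)) x = _ at hx
  rw [hx]
  change _ + _ * evalHolo x (Φ * g) = evalHolo x (Φ * heunOp _ _ _ _ g)
  simp only [heunOp, logD, Fin.sum_univ_three, Fin.succ_zero_eq_one, Fin.succ_one_eq_two,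
    show Fin.succ (2 : Fin 3) = 3 from rfl, map_add, map_mul, map_sub, map_neg, map_pow, map_smul,
    map_ofNat, evalHolo_algebraMap, evalHolo_p, evalHolo_r, smul_eq_mul]
  -- In the first-order coefficient `2 w² φ` the zeros of `w²` cancel the poles of `φ`.
  have hq : 2 * (4 * (P.weierstrassP x - e P 0) * (P.weierstrassP x - e P 1) *
      (P.weierstrassP x - e P 2)) * (γ 1 / 2 * (P.weierstrassP x - e P 0)⁻¹ +
        γ 2 / 2 * (P.weierstrassP x - e P 1)⁻¹ + γ 3 / 2 * (P.weierstrassP x - e P 2)⁻¹) =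
      4 * (γ 1 * (P.weierstrassP x - e P 1) * (P.weierstrassP x - e P 2) +
        γ 2 * (P.weierstrassP x - e P 0) * (P.weierstrassP x - e P 2) +
        γ 3 * (P.weierstrassP x - e P 0) * (P.weierstrassP x - e P 1)) := by
    field_simp
  rw [hq]
  linear_combination -(evalHolo x Φ * evalHolo x g) * hid

end IsRegularDomain

end HeunDarboux

/-! ### Logarithmic derivatives of the gauge factors and the intertwining relation. -/

namespace HeunDarboux
namespace IsRegularDomain

variable {P : PeriodPair} {U : Set ℂ}

lemma holo_ext {f g : Holo U} (h : ∀ x, evalHolo x f = evalHolo x g) : f = g :=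
  Subtype.ext (funext h)

lemma D_w (hU : IsRegularDomain P U) : hU.D hU.w = hU.logD (fun _ => 1) * hU.w := by
  suffices h : hU.w * hU.D hU.w = hU.w ^ 2 * hU.logD (fun _ => 1) by
    linear_combination hU.wInv * h + (hU.logD (fun _ => 1) * hU.w - hU.D hU.w) * hU.w_mul_wInv
  rw [w_mul_D_w, w_sq]
  refine holo_ext fun x => ?_
  have h0 := hU.sub_ne_zero x 0
  have h1 := hU.sub_ne_zero x 1
  have h2 := hU.sub_ne_zero x 2
  simp only [logD, Fin.sum_univ_three, map_add, map_mul, map_sub, map_smul, map_ofNat,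
    evalHolo_algebraMap, evalHolo_p, evalHolo_r, smul_eq_mul]
  field_simp
  ring

lemma logD_add (hU : IsRegularDomain P U) (γ γ' : Fin 4 → ℂ) :
    hU.logD γ + hU.logD γ' = hU.logD (γ + γ') := by
  simp [logD, ← Finset.sum_add_distrib, ← add_smul, add_div]

lemma natCast_mul_logD (hU : IsRegularDomain P U) (n : ℕ) (γ : Fin 4 → ℂ) :
    n * hU.logD γ = hU.logD ((n : ℂ) • γ) := by
  rw [logD, logD, ← nsmul_eq_mul, Finset.smul_sum]
  refine Finset.sum_congr rfl fun i _ => ?_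
  rw [← Nat.cast_smul_eq_nsmul ℂ, smul_smul, Pi.smul_apply, smul_eq_mul, mul_div_assoc]

lemma D_w_pow (hU : IsRegularDomain P U) (n : ℕ) :
    hU.D (hU.w ^ n) = hU.logD (fun _ => n) * hU.w ^ n := by
  have : (fun _ => n : Fin 4 → ℂ) = (n : ℂ) • fun _ => 1 := by
    ext
    simp
  rw [this, ← natCast_mul_logD, Derivation.leibniz_pow, D_w]
  cases n with
  | zero => simp
  | succ n =>
    simp only [Nat.add_sub_cancel, smul_eq_mul, nsmul_eq_mul]
    ring

variable {lg : Fin 3 → ℂ → ℂ}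

/-- A power of `℘ - e_k` as a holomorphic function on `U`. -/
noncomputable def power (hlg : IsLogBranch P U lg) (i : Fin 3) (c : ℂ) : Holo U :=
  ⟨fun x => Complex.exp (c * lg i x), mem_holo_of_differentiableOn
    ((hlg.differentiableOn i).const_mul c).cexp⟩

lemma D_power (hU : IsRegularDomain P U) (hlg : IsLogBranch P U lg) (i : Fin 3) (c : ℂ) :
    hU.D (power hlg i c) = c • hU.r i * power hlg i c := by
  suffices h : holoDeriv hU.isOpen (power hlg i c) = hU.w * (c • hU.r i * power hlg i c) by
    rw [hU.holoDeriv_eq] at h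
    linear_combination hU.wInv * h +
      (c • hU.r i * power hlg i c - hU.D (power hlg i c)) * hU.w_mul_wInv
  refine holo_ext fun x => ?_
  have hd := ((hlg.differentiableOn i).differentiableAt (hU.isOpen.mem_nhds x.2)).hasDerivAt
  -- Differentiating `exp (lg i) = ℘ - e_i` gives the derivative of the chosen logarithm.
  have h1 : deriv (fun z => Complex.exp (lg i z)) x = P.derivWeierstrassP x := by
    have : (fun z => Complex.exp (lg i z)) =ᶠ[nhds (x : ℂ)]
        fun z => P.weierstrassP z - e P i :=
      Set.EqOn.eventuallyEq_of_mem (hlg.exp_eq i) (hU.isOpen.mem_nhds x.2)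
    rw [this.deriv_eq, deriv_sub_const, P.deriv_weierstrassP]
  rw [hd.cexp.deriv, hlg.exp_eq i x x.2] at h1
  have h2 : ddx (fun x : U => Complex.exp (c * lg i x)) x = _ :=
    (ddx_restrict hU.isOpen (fun z => Complex.exp (c * lg i z)) x).trans
      (hd.const_mul c).cexp.deriv
  have h0 := hU.sub_ne_zero x i
  change ddx (fun x : U => Complex.exp (c * lg i x)) x = P.derivWeierstrassP x *
    (c * (P.weierstrassP x - e P i)⁻¹ * Complex.exp (c * lg i x))
  rw [h2, ← h1]
  field_simp

/-- `∏ (℘ - e_k)^{γ_k/2}` as a holomorphic function on `U`. -/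
noncomputable def gaugeHolo (hlg : IsLogBranch P U lg) (γ : Fin 4 → ℂ) : Holo U :=
  ∏ i : Fin 3, power hlg i (γ i.succ / 2)

lemma coe_gaugeHolo (hlg : IsLogBranch P U lg) (γ : Fin 4 → ℂ) :
    (gaugeHolo hlg γ : U → ℂ) = gauge U lg γ := by
  ext x
  change evalHolo x (gaugeHolo hlg γ) = _
  rw [gaugeHolo, map_prod]
  rfl

lemma gauge_ne_zero (lg : Fin 3 → ℂ → ℂ) (γ : Fin 4 → ℂ) (x : U) : gauge U lg γ x ≠ 0 :=
  Finset.prod_ne_zero_iff.mpr fun _ _ => Complex.exp_ne_zero _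

/-- The inverse of `∏ (℘ - e_k)^{γ_k/2}`. -/
noncomputable def gaugeInv (hlg : IsLogBranch P U lg) (γ : Fin 4 → ℂ) : Holo U :=
  ⟨_, inv_mem_holo (gaugeHolo hlg γ) fun x => by
    rw [coe_gaugeHolo]
    exact gauge_ne_zero lg γ x⟩

lemma gaugeHolo_mul_gaugeInv (hlg : IsLogBranch P U lg) (γ : Fin 4 → ℂ) :
    gaugeHolo hlg γ * gaugeInv hlg γ = 1 := by
  refine holo_ext fun x => mul_inv_cancel₀ ?_
  rw [coe_gaugeHolo]
  exact gauge_ne_zero lg γ x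

lemma D_gaugeHolo (hU : IsRegularDomain P U) (hlg : IsLogBranch P U lg) (γ : Fin 4 → ℂ) :
    hU.D (gaugeHolo hlg γ) = hU.logD γ * gaugeHolo hlg γ := by
  simp only [gaugeHolo, logD, Fin.prod_univ_three, Fin.sum_univ_three, Derivation.leibniz, D_power,
    smul_eq_mul]
  ring

/-- As `w² = 4 ∏ (℘ - e_k)`, a factor `wⁿ` raises each exponent by `n`. Only the logarithmic
derivative enters `hamiltonian_mul`, so `w` need not be written through branches of square roots. -/
lemma D_w_pow_mul_gaugeHolo (hU : IsRegularDomain P U) (hlg : IsLogBranch P U lg) (n : ℕ)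
    (γ : Fin 4 → ℂ) : hU.D (hU.w ^ n * gaugeHolo hlg γ) =
      hU.logD (fun i => γ i + n) * (hU.w ^ n * gaugeHolo hlg γ) := by
  have h : hU.logD γ + hU.logD (fun _ => n) = hU.logD (fun i => γ i + n) := hU.logD_add _ _
  rw [Derivation.leibniz, D_w_pow, D_gaugeHolo, ← h, smul_eq_mul, smul_eq_mul]
  ring

lemma darboux_eq (hU : IsRegularDomain P U) (hlg : IsLogBranch P U lg) (γ : Fin 4 → ℂ) (d : ℕ)
    (f : Holo U) : darboux P lg γ d (f : U → ℂ) =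
      ((hU.w ^ (d + 1) * gaugeHolo hlg γ * hU.D^[d + 1] (gaugeInv hlg γ * f) : Holo U) :
        U → ℂ) := by
  have h : (fun y => (gauge U lg γ y)⁻¹ * (f : U → ℂ) y) =
      ((gaugeInv hlg γ * f : Holo U) : U → ℂ) := by
    rw [← coe_gaugeHolo hlg]
    rfl
  ext x
  rw [darboux, h, ← coe_D_iterate hU, ← coe_gaugeHolo hlg]
  rfl

/-- The Darboux transformation intertwines the two Hamiltonians. -/
theorem hamiltonian_darboux (hU : IsRegularDomain P U) (hlg : IsLogBranch P U lg)
    {l α : Fin 4 → ℂ} (hα : ∀ i, α i = -l i ∨ α i = l i + 1) {d : ℕ}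
    (hd : (d : ℂ) = -∑ i, α i / 2) (f : Holo U) :
    hamiltonian P l (darboux P lg (fun i => -α i - d) d (f : U → ℂ)) =
      darboux P lg (fun i => -α i - d) d
        (hamiltonian P (fun i => α i + d) (f : U → ℂ)) := by
  set β : Fin 4 → ℂ := fun i => -α i - d with hβ
  have hw := hU.D_w_pow_mul_gaugeHolo hlg (d + 1) β
  have hγ : (fun i => β i + ((d + 1 : ℕ) : ℂ)) = fun i => 1 - α i := by
    ext i
    simp only [hβ, Nat.cast_add, Nat.cast_one]
    ring
  rw [hγ] at hw
  have ht : hU.D (hU.p - algebraMap ℂ _ (e P 0)) = 1 := by simp [D_p]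
  have hf : f = gaugeHolo hlg β * (gaugeInv hlg β * f) := by
    rw [← mul_assoc, gaugeHolo_mul_gaugeInv, one_mul]
  -- Here `β(β - 1) = (α + d)(α + d + 1)`. For the outer factor, `(1 - α)(-α) = α(α - 1) = l(l +
  -- 1)`.
  have h1 := hU.hamiltonian_mul (l := fun i => α i + d) (fun i => by simp only [hβ]; ring)
    (hU.D_gaugeHolo hlg β) (gaugeInv hlg β * f)
  rw [← hf] at h1
  rw [h1, hU.darboux_eq hlg, hU.darboux_eq hlg, hU.hamiltonian_mul (γ := fun i => 1 - α i)
    (fun i => by rcases hα i with h | h <;> rw [h] <;> ring) hw,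
    heunOp_iterate hU.D ht (e_sum P) hd]
  rw [← mul_assoc (gaugeInv hlg β), mul_comm (gaugeInv hlg β) (gaugeHolo hlg β), gaugeHolo_mul_gaugeInv, one_mul]

end IsRegularDomain
end HeunDarboux

/-! ### Determinants of tridiagonal matrices. -/

namespace HeunDarboux

section Tridiagonal

variable {R : Type*}

/-- The tridiagonal matrix with diagonal `a`, superdiagonal `b` and subdiagonal `c`. -/
def tridiag [Zero R] (n : ℕ) (a b c : ℕ → R) : Matrix (Fin n) (Fin n) R :=
  Matrix.of fun i j => if (i : ℕ) = j then a i else if (j : ℕ) = i + 1 then b i else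
    if (i : ℕ) = j + 1 then c j else 0

lemma tridiag_submatrix_succ [Zero R] (n : ℕ) (a b c : ℕ → R) :
    (tridiag (n + 1) a b c).submatrix Fin.succ Fin.succ =
      tridiag n (fun i => a (i + 1)) (fun i => b (i + 1)) (fun i => c (i + 1)) := by
  ext i j
  simp [tridiag]

/-- The continuant recursion, from expansion along the first row. Off-diagonal entries enter it only
through the product `b 0 * c 0`. -/
lemma det_tridiag_succ_succ [CommRing R] (n : ℕ) (a b c : ℕ → R) :
    (tridiag (n + 2) a b c).det =
      a 0 * (tridiag (n + 1) (fun i => a (i + 1)) (fun i => b (i + 1)) (fun i => c (i + 1))).det -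
      b 0 * c 0 *
        (tridiag n (fun i => a (i + 2)) (fun i => b (i + 2)) (fun i => c (i + 2))).det := by
  have h1 : ((tridiag (n + 2) a b c).submatrix Fin.succ (Fin.succAbove 1)).det = c 0 *
      (tridiag n (fun i => a (i + 2)) (fun i => b (i + 2)) (fun i => c (i + 2))).det := by
    rw [Matrix.det_succ_column_zero, Fin.sum_univ_succ, Finset.sum_eq_zero, add_zero]
    · have h2 : ((tridiag (n + 2) a b c).submatrix Fin.succ (Fin.succAbove 1)).submatrix
          (Fin.succAbove 0) Fin.succ =
          tridiag n (fun i => a (i + 2)) (fun i => b (i + 2)) (fun i => c (i + 2)) := by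
        ext i j
        simp [tridiag]
      rw [h2]
      simp [tridiag]
    · intro i _
      simp [tridiag]
  rw [Matrix.det_succ_row_zero, Fin.sum_univ_succ, Fin.sum_univ_succ, Finset.sum_eq_zero]
  · rw [Fin.succ_zero_eq_one, h1, Fin.succAbove_zero, tridiag_submatrix_succ]
    simp [tridiag]
    ring
  · intro j _
    simp [tridiag]

/-- The determinant of a tridiagonal matrix depends only on the diagonal and on the products of
opposite off-diagonal entries. -/
lemma det_tridiag_congr [CommRing R] (n : ℕ) (a b c b' c' : ℕ → R)
    (h : ∀ i, b i * c i = b' i * c' i) : (tridiag n a b c).det = (tridiag n a b' c').det := by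
  induction n using Nat.strong_induction_on generalizing a b c b' c' with
  | _ n ih =>
    match n with
    | 0 => simp
    | 1 => simp [tridiag]
    | n + 2 =>
      rw [det_tridiag_succ_succ, det_tridiag_succ_succ, h 0,
        ih (n + 1) (by omega) _ _ _ _ _ fun i => h (i + 1),
        ih n (by omega) _ _ _ _ _ fun i => h (i + 2)]

open Polynomial in
lemma charmatrix_tridiag [CommRing R] (n : ℕ) (a b c : ℕ → R) :
    (tridiag n a b c).charmatrix =
      tridiag n (fun i => X - C (a i)) (fun i => -C (b i)) (fun i => -C (c i)) := by
  ext1 i j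
  by_cases hij : i = j
  · subst hij
    simp [tridiag]
  · have : (i : ℕ) ≠ j := fun h => hij (Fin.ext h)
    rw [Matrix.charmatrix_apply_ne _ _ _ hij]
    simp only [tridiag, Matrix.of_apply, if_neg this]
    split_ifs <;> simp

lemma charpoly_tridiag_congr [CommRing R] (n : ℕ) (a b c b' c' : ℕ → R)
    (h : ∀ i, b i * c i = b' i * c' i) :
    (tridiag n a b c).charpoly = (tridiag n a b' c').charpoly := by
  rw [Matrix.charpoly, Matrix.charpoly, charmatrix_tridiag, charmatrix_tridiag]
  refine det_tridiag_congr _ _ _ _ _ _ fun i => ?_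
  rw [neg_mul_neg, neg_mul_neg, ← map_mul, ← map_mul, h]

/-- `z j` is the lowering coefficient of column `j`, hence the shift `z (i + 1)` on the
superdiagonal. The conditions `z 0 = 0` and `c d = 0` remove the truncated `u (0 - 1)` and the
missing `u (d + 1)`. -/
lemma sum_tridiag_smul [Semiring R] {M : Type*} [AddCommMonoid M] [Module R M] (d : ℕ)
    (a z c : ℕ → R) (hz : z 0 = 0) (hc : c d = 0) (u : ℕ → M) (j : Fin (d + 1)) :
    ∑ i, tridiag (d + 1) a (fun i => z (i + 1)) c i j • u i =
      c j • u (j + 1) + a j • u j + z j • u (j - 1) := by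
  have hs (i : Fin (d + 1)) : tridiag (d + 1) a (fun i => z (i + 1)) c i j • u i =
      (if (i : ℕ) = j + 1 then c j • u (j + 1) else 0) + (if (i : ℕ) = j then a j • u j else 0) +
        (if (i : ℕ) + 1 = j then z j • u (j - 1) else 0) := by
    simp only [tridiag, Matrix.of_apply]
    rcases eq_or_ne (i : ℕ) j with h | h
    · simp [h]
    · rcases eq_or_ne (i + 1 : ℕ) j with h' | h'
      · rw [if_neg h, if_pos h'.symm, if_neg (by omega), if_neg h, if_pos h', ← h']
        simp
      · rcases eq_or_ne (i : ℕ) (j + 1) with h'' | h''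
        · rw [if_neg h, if_neg h'.symm, if_pos h'', if_pos h'', if_neg h, if_neg h', h'']
          simp
        · simp [h, h', h'', Ne.symm h']
  simp only [hs, Finset.sum_add_distrib]
  rw [Fin.sum_univ_eq_sum_range (fun i => if i = (j : ℕ) + 1 then c j • u (j + 1) else 0),
    Fin.sum_univ_eq_sum_range (fun i => if i = (j : ℕ) then a j • u j else 0),
    Fin.sum_univ_eq_sum_range (fun i => if i + 1 = (j : ℕ) then z j • u (j - 1) else 0)]
  have hj := j.2
  congr 1
  · congr 1
    · rw [Finset.sum_ite_eq']
      rcases eq_or_ne (j : ℕ) d with h | h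
      · simp [h, hc]
      · rw [if_pos (Finset.mem_range.mpr (by omega))]
    · rw [Finset.sum_ite_eq', if_pos (Finset.mem_range.mpr hj)]
  · rcases hj' : (j : ℕ) with _ | k
    · simp [hz]
    · simp only [Nat.add_right_cancel_iff]
      rw [Finset.sum_ite_eq', if_pos (Finset.mem_range.mpr (by omega))]

end Tridiagonal

/-! ### The Heun operator on powers of `t`. -/

section HeunMatrix

/-- The coefficient by which `heunOp` raises the degree of `t ^ s`. -/
def heunUp (γ : Fin 4 → ℂ) (s : ℂ) : ℂ :=
  4 * (s * (s - 1)) + (6 + 4 * (γ 1 + γ 2 + γ 3)) * s +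
    ((γ 1 + γ 2 + γ 3) * (γ 1 + γ 2 + γ 3 + 1) - γ 0 * (γ 0 - 1))

/-- The diagonal coefficient of `heunOp` on the powers of `t`. -/
def heunDiag (e : Fin 3 → ℂ) (γ : Fin 4 → ℂ) (s : ℂ) : ℂ :=
  -4 * (e 1 - e 0 + (e 2 - e 0)) * (s * (s - 1)) +
    (-4 * (1 + γ 1) * (e 1 - e 0 + (e 2 - e 0)) -
      4 * (γ 2 * (e 2 - e 0) + γ 3 * (e 1 - e 0))) * s +
    (e 0 * ((γ 1 + γ 2 + γ 3) * (γ 1 + γ 2 + γ 3 + 1) - γ 0 * (γ 0 - 1)) +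
      γ 1 ^ 2 * e 0 + γ 2 ^ 2 * e 1 + γ 3 ^ 2 * e 2 -
      2 * (γ 2 * γ 3 * e 0 + γ 1 * γ 3 * e 1 + γ 1 * γ 2 * e 2))

/-- The coefficient by which `heunOp` lowers the degree of `t ^ s`. -/
def heunDown (e : Fin 3 → ℂ) (γ : Fin 4 → ℂ) (s : ℂ) : ℂ :=
  4 * (e 1 - e 0) * (e 2 - e 0) * (s * (s - 1)) +
    (2 + 4 * γ 1) * (e 1 - e 0) * (e 2 - e 0) * s

lemma heunOp_pow {A : Type*} [CommRing A] [Algebra ℂ A] (D : Derivation ℂ A A) {t : A}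
    (ht : D t = 1) (e : Fin 3 → ℂ) (γ : Fin 4 → ℂ) (n : ℕ) :
    heunOp D t e γ (t ^ n) = -(heunUp γ n • t ^ (n + 1) +
      heunDiag e γ n • t ^ n + heunDown e γ n • t ^ (n - 1)) := by
  simp only [Algebra.smul_def, heunUp, heunDiag, heunDown]
  -- For `n = 0` the truncated exponent `n - 1` is harmless, since `heunDown` vanishes at `0`.
  rcases n with _ | _ | n
  · simp [heunOp]
  · simp [heunOp, ht]
    ring
  · have h1 : D (t ^ (n + 2)) = (n + 2) * t ^ (n + 1) := by
      simp [D.leibniz_pow, ht]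
    have h2 : D ((n + 2) * t ^ (n + 1)) = (n + 2) * (n + 1) * t ^ n := by
      have h3 : D ((n : A) + 2) = 0 := by
        rw [map_add, D.map_natCast]
        simpa using D.map_natCast 2
      simp [D.leibniz, D.leibniz_pow, ht, h3]
      ring
    rw [heunOp, h1, h2]
    simp
    ring

/-- `heunOp` as a linear map. -/
def heunLin {A : Type*} [CommRing A] [Algebra ℂ A] (D : Derivation ℂ A A) (t : A)
    (e : Fin 3 → ℂ) (γ : Fin 4 → ℂ) : A →ₗ[ℂ] A where
  toFun := heunOp D t e γ
  map_add' f g := by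
    simp only [heunOp, map_add]
    ring
  map_smul' c f := by
    simp only [heunOp, Derivation.map_smul, RingHom.id_apply]
    simp only [Algebra.smul_def]
    ring

/-- The matrix of the Hamiltonian on `V`. -/
def heunMatrix (e : Fin 3 → ℂ) (γ : Fin 4 → ℂ) (d : ℕ) : Matrix (Fin (d + 1)) (Fin (d + 1)) ℂ :=
  tridiag (d + 1) (fun n => -heunDiag e γ n) (fun n => -heunDown e γ (n + 1))
    (fun n => -heunUp γ n)

/-- With `σ = γ₁ + γ₂ + γ₃`, `heunUp γ s = (2s + σ + γ₀)(2s + σ + 1 - γ₀)`, and the first factor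
vanishes at `s = d`. This is what makes `V` invariant. -/
lemma heunUp_self {γ : Fin 4 → ℂ} {d : ℕ} (hd : (d : ℂ) = -∑ i, γ i / 2) : heunUp γ d = 0 := by
  have h0 : γ 0 = -2 * d - γ 1 - γ 2 - γ 3 := by
    rw [Fin.sum_univ_four] at hd
    linear_combination 2 * hd
  rw [heunUp, h0]
  ring

lemma sum_heunMatrix_smul {A : Type*} [CommRing A] [Algebra ℂ A] (D : Derivation ℂ A A) {t : A}
    (ht : D t = 1) (e : Fin 3 → ℂ) {γ : Fin 4 → ℂ} {d : ℕ} (hd : (d : ℂ) = -∑ i, γ i / 2)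
    (j : Fin (d + 1)) :
    ∑ i, heunMatrix e γ d i j • t ^ (i : ℕ) = heunOp D t e γ (t ^ (j : ℕ)) := by
  have h := sum_tridiag_smul d (fun n => -heunDiag e γ n) (fun n => -heunDown e γ n)
    (fun n => -heunUp γ n) (by simp [heunDown]) (by simp [heunUp_self hd]) (fun n => t ^ n) j
  push_cast at h
  rw [heunMatrix, h, heunOp_pow D ht]
  simp only [neg_smul, neg_add]

/-- Under `n ↦ d - n` the diagonals agree. With `E = (e 1 - e 0)(e 2 - e 0)`, both products of
opposite off-diagonal entries are `4E(n + 1)(d - n)(2n + 1 + 2α₁)(2d - 2n - 1 + 2α₀)`; only the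
distribution of the linear factors between the two entries differs. -/
lemma charpoly_heunMatrix {e : Fin 3 → ℂ} (he : e 0 + e 1 + e 2 = 0) {α : Fin 4 → ℂ} {d : ℕ}
    (hd : (d : ℂ) = -∑ i, α i / 2) :
    (heunMatrix e α d).charpoly = (heunMatrix e (fun i => -α i - d) d).charpoly := by
  have h0 : α 0 = -2 * d - α 1 - α 2 - α 3 := by
    rw [Fin.sum_univ_four] at hd
    linear_combination 2 * hd
  have h2 : e 2 = -e 0 - e 1 := by linear_combination he
  rw [← Matrix.charpoly_reindex Fin.revPerm (heunMatrix e (fun i => -α i - d) d)]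
  have h : Matrix.reindex Fin.revPerm Fin.revPerm (heunMatrix e (fun i => -α i - d) d) =
      tridiag (d + 1) (fun n => -heunDiag e α n)
        (fun n => -heunUp (fun i => -α i - d) (d - n - 1))
        (fun n => -heunDown e (fun i => -α i - d) (d - n)) := by
    have hc (k : Fin (d + 1)) : ((d - k : ℕ) : ℂ) = d - k := Nat.cast_sub (by omega)
    ext i j
    have hi := i.2
    have hj := j.2
    simp only [heunMatrix, tridiag, Matrix.reindex_apply, Matrix.submatrix_apply,
      Matrix.of_apply, Fin.revPerm_symm, Fin.revPerm_apply, Fin.val_rev, Nat.add_sub_add_right, hc]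
    rcases eq_or_ne (i : ℕ) j with h | h
    · rw [if_pos h, if_pos (by omega), heunDiag, heunDiag, h0, h2]
      ring
    · rw [if_neg h, if_neg (by omega)]
      rcases eq_or_ne (j : ℕ) (i + 1) with h' | h'
      · rw [if_pos h', if_neg (by omega), if_pos (by omega), h']
        push_cast
        congr 2
        ring
      · rw [if_neg h']
        rcases eq_or_ne (i : ℕ) (j + 1) with h'' | h''
        · rw [if_pos h'', if_pos (by omega), h'']
          push_cast
          congr 2
          ring
        · rw [if_neg h'', if_neg (by omega), if_neg (by omega)]
  rw [h]
  refine charpoly_tridiag_congr _ _ _ _ _ _ fun n => ?_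
  simp only [heunUp, heunDown]
  rw [h0]
  ring

end HeunMatrix

end HeunDarboux

/-! ### Dimension of `V` and the action of the Hamiltonian on it. -/

namespace HeunDarboux
namespace IsRegularDomain

open Module

variable {P : PeriodPair} {U : Set ℂ} {lg : Fin 3 → ℂ → ℂ}

/-- The coordinate `℘ - e₁`. -/
noncomputable def t (hU : IsRegularDomain P U) : Holo U := hU.p - algebraMap ℂ _ (e P 0)

lemma D_t (hU : IsRegularDomain P U) : hU.D hU.t = 1 := by simp [t, D_p]

/-- A finite connected image would be a point, contradicting `℘' ≠ 0`. Hence a polynomial in `℘`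
that vanishes on `U` is zero, which gives linear independence in `V`. -/
lemma infinite_image_weierstrassP (hU : IsRegularDomain P U) (hUc : IsConnected U) :
    (P.weierstrassP '' U).Infinite := by
  have hd : DifferentiableOn ℂ P.weierstrassP U :=
    P.differentiableOn_weierstrassP.mono fun x hx => hU.notMem ⟨x, hx⟩
  have h := hUc.isPreconnected.image _ hd.continuousOn
  by_contra hfin
  have hsub : (P.weierstrassP '' U).Subsingleton := by
    by_contra hs
    exact hfin (h.infinite_of_nontrivial (Set.not_subsingleton_iff.mp hs))
  obtain ⟨x, hx⟩ := hUc.nonempty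
  have heq : P.weierstrassP =ᶠ[nhds x] fun _ => P.weierstrassP x :=
    Set.EqOn.eventuallyEq_of_mem (s := U) (fun y hy => hsub ⟨y, hy, rfl⟩ ⟨x, hx, rfl⟩)
      (hU.isOpen.mem_nhds hx)
  have := heq.deriv_eq
  rw [P.deriv_weierstrassP, deriv_const] at this
  exact hU.derivWeierstrassP_ne_zero ⟨x, hx⟩ this

/-- The function `Φ (℘ - e₁)^n`. -/
noncomputable def vec (hU : IsRegularDomain P U) (hlg : IsLogBranch P U lg) (γ : Fin 4 → ℂ)
    (n : ℕ) : Holo U := gaugeHolo hlg γ * hU.t ^ n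

lemma vec_mem_V (hU : IsRegularDomain P U) (hlg : IsLogBranch P U lg) (γ : Fin 4 → ℂ) {d n : ℕ}
    (hn : n < d + 1) : (hU.vec hlg γ n : U → ℂ) ∈ V P U lg γ d := by
  have h : (hU.vec hlg γ n : U → ℂ) = ∑ m ∈ Finset.range (n + 1),
      ((-e P 0) ^ (n - m) * (n.choose m : ℂ)) •
        fun x : U => gauge U lg γ x * P.weierstrassP x ^ m := by
    ext x
    change evalHolo x (gaugeHolo hlg γ * hU.t ^ n) = _
    have hg : evalHolo x (gaugeHolo hlg γ) = gauge U lg γ x := congr_fun (coe_gaugeHolo hlg γ) x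
    rw [map_mul, map_pow, t, map_sub, evalHolo_p, evalHolo_algebraMap, sub_eq_add_neg, add_pow, hg,
      Finset.mul_sum, Finset.sum_apply]
    refine Finset.sum_congr rfl fun m _ => ?_
    simp only [Pi.smul_apply, smul_eq_mul]
    ring
  rw [h]
  refine Submodule.sum_mem _ fun m hm => Submodule.smul_mem _ _ (Submodule.subset_span ?_)
  rw [Finset.mem_range] at hm
  exact ⟨⟨m, by omega⟩, rfl⟩

lemma linearIndependent_vec (hU : IsRegularDomain P U) (hUc : IsConnected U)
    (hlg : IsLogBranch P U lg) (γ : Fin 4 → ℂ) (d : ℕ) :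
    LinearIndependent ℂ fun n : Fin (d + 1) =>
      (⟨(hU.vec hlg γ n : U → ℂ), hU.vec_mem_V hlg γ n.2⟩ : V P U lg γ d) := by
  rw [Fintype.linearIndependent_iff]
  intro c hc i
  set q : Polynomial ℂ := ∑ n : Fin (d + 1), Polynomial.monomial (n : ℕ) (c n) with hq
  have h0 : ∑ n, c n • hU.vec hlg γ n = 0 := by
    have := congr_arg (V P U lg γ d).subtype hc
    rw [map_sum, map_zero] at this
    apply Subtype.ext
    change (Holo U).val _ = _
    rw [map_sum]
    exact this
  have hq0 : q = 0 := by
    refine Polynomial.eq_zero_of_infinite_isRoot q (Set.Infinite.mono ?_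
      ((hU.infinite_image_weierstrassP hUc).image (sub_left_injective (b := e P 0)).injOn))
    rintro _ ⟨_, ⟨x, hx, rfl⟩, rfl⟩
    lift x to U using hx
    have h := congr_arg (evalHolo x) h0
    simp only [vec, map_sum, map_smul, map_mul, map_pow, map_zero, t, map_sub, evalHolo_p,
      evalHolo_algebraMap, smul_eq_mul, mul_left_comm (c _), ← Finset.mul_sum] at h
    have hg : evalHolo x (gaugeHolo hlg γ) ≠ 0 := by
      have hg : evalHolo x (gaugeHolo hlg γ) = gauge U lg γ x :=
        congr_fun (coe_gaugeHolo hlg γ) x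
      rw [hg]
      exact gauge_ne_zero lg γ x
    simpa [hq, Polynomial.IsRoot, Polynomial.eval_finsetSum] using
      (mul_eq_zero.mp h).resolve_left hg
  have := congr_arg (fun q => q.coeff i) hq0
  simpa [hq, Polynomial.finsetSum_coeff, Polynomial.coeff_monomial, Fin.val_inj] using this

lemma finrank_V (hU : IsRegularDomain P U) (hUc : IsConnected U)
    (hlg : IsLogBranch P U lg) (γ : Fin 4 → ℂ) (d : ℕ) :
    finrank ℂ (V P U lg γ d) = d + 1 := by
  refine le_antisymm ?_ ?_
  · simpa using! finrank_range_le_card (R := ℂ) fun (n : Fin (d + 1)) (x : U) =>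
      gauge U lg γ x * P.weierstrassP x ^ (n : ℕ)
  · simpa using (hU.linearIndependent_vec hUc hlg γ d).fintype_card_le_finrank

/-- The basis of `V` formed by the functions `Φ (℘ - e₁)^n`. -/
noncomputable def basisV (hU : IsRegularDomain P U) (hUc : IsConnected U)
    (hlg : IsLogBranch P U lg) (γ : Fin 4 → ℂ) (d : ℕ) :
    Basis (Fin (d + 1)) ℂ (V P U lg γ d) :=
  basisOfLinearIndependentOfCardEqFinrank (hU.linearIndependent_vec hUc hlg γ d)
    (by rw [finrank_V hU hUc hlg, Fintype.card_fin])

lemma sum_smul_basisV (hU : IsRegularDomain P U) (hUc : IsConnected U)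
    (hlg : IsLogBranch P U lg) (γ : Fin 4 → ℂ) (d : ℕ) (c : Fin (d + 1) → ℂ) :
    ((∑ i, c i • hU.basisV hUc hlg γ d i : V P U lg γ d) : U → ℂ) =
      ((gaugeHolo hlg γ * ∑ i, c i • hU.t ^ (i : ℕ) : Holo U) : U → ℂ) := by
  change (V P U lg γ d).subtype (∑ i, c i • hU.basisV hUc hlg γ d i) =
    (Holo U).val (gaugeHolo hlg γ * ∑ i, c i • hU.t ^ (i : ℕ))
  simp only [Finset.mul_sum, map_sum, map_smul, mul_smul_comm]
  refine Finset.sum_congr rfl fun i _ => ?_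
  rw [basisV, coe_basisOfLinearIndependentOfCardEqFinrank]
  rfl

/-- The Hamiltonian preserves `V`, and its matrix is `heunMatrix`. -/
theorem hamiltonian_toLin (hU : IsRegularDomain P U) (hUc : IsConnected U)
    (hlg : IsLogBranch P U lg) {l γ : Fin 4 → ℂ}
    (hl : ∀ i, l i * (l i + 1) = γ i * (γ i - 1)) {d : ℕ} (hd : (d : ℂ) = -∑ i, γ i / 2)
    (f : V P U lg γ d) :
    (Matrix.toLin (hU.basisV hUc hlg γ d) (hU.basisV hUc hlg γ d) (heunMatrix (e P) γ d) f :
      U → ℂ) = hamiltonian P l (f : U → ℂ) := by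
  set b := hU.basisV hUc hlg γ d
  have hf : (f : U → ℂ) = _ :=
    (congr_arg _ (b.sum_repr f).symm).trans (hU.sum_smul_basisV hUc hlg γ d (b.repr f))
  rw [hf, hU.hamiltonian_mul hl (hU.D_gaugeHolo hlg γ), Matrix.toLin_apply,
    hU.sum_smul_basisV hUc hlg γ d]
  congr 2
  change _ = heunLin hU.D hU.t (e P) γ _
  simp only [map_sum, map_smul, Matrix.mulVec, dotProduct, Finset.sum_smul]
  rw [Finset.sum_comm]
  refine Finset.sum_congr rfl fun j _ => ?_
  change _ = _ • heunOp hU.D hU.t (e P) γ _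
  rw [← sum_heunMatrix_smul hU.D hU.D_t (e P) hd, Finset.smul_sum]
  refine Finset.sum_congr rfl fun i _ => ?_
  rw [smul_smul, mul_comm]

end IsRegularDomain
end HeunDarboux

open HeunDarboux in
theorem mainTheorem6 (P : PeriodPair)
    -- a domain avoiding the half periods, with branches of the logarithms of `℘ - e_k`
    (U : Set ℂ) (hUo : IsOpen U) (hUc : IsConnected U) (hUP : ∀ x ∈ U, 2 * x ∉ P.lattice)
    (lg : Fin 3 → ℂ → ℂ) (hlg : IsLogBranch P U lg)
    (l α : Fin 4 → ℂ) (hα : ∀ i, α i = -l i ∨ α i = l i + 1)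
    (d : ℕ) (hd : (d : ℂ) = -∑ i, α i / 2) :
    -- (i)
    (∀ f : U → ℂ, IsHolo f →
      hamiltonian P l (darboux P lg (fun i => -α i - d) d f) =
        darboux P lg (fun i => -α i - d) d (hamiltonian P (fun i => α i + d) f)) ∧
    -- (ii), including that the two operators act on the two `(d + 1)`-dimensional spaces
    (Module.finrank ℂ (V P U lg α d) = d + 1 ∧
      Module.finrank ℂ (V P U lg (fun i => -α i - d) d) = d + 1 ∧
      ∃ (T : Module.End ℂ (V P U lg α d))
        (T' : Module.End ℂ (V P U lg (fun i => -α i - d) d)),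
        (∀ f : V P U lg α d, (T f : U → ℂ) = hamiltonian P l (f : U → ℂ)) ∧
        (∀ f : V P U lg (fun i => -α i - d) d,
          (T' f : U → ℂ) = hamiltonian P (fun i => α i + d) (f : U → ℂ)) ∧
        T.charpoly = T'.charpoly) := by
  have hU : IsRegularDomain P U := ⟨hUo, hUP⟩
  have hl i : l i * (l i + 1) = α i * (α i - 1) := by
    rcases hα i with h | h <;> rw [h] <;> ring
  -- The four shifts by `d` contribute `2d` and the `α`-part contributes `-d`.
  have hd' : (d : ℂ) = -∑ i, (-α i - d) / 2 := by
    rw [Fin.sum_univ_four] at hd ⊢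
    linear_combination -hd
  -- Unification supplies both endomorphisms as `Matrix.toLin` of the matrices `heunMatrix`.
  refine ⟨fun f hf => hU.hamiltonian_darboux hlg hα hd ⟨f, hf⟩, hU.finrank_V hUc hlg _ d,
    hU.finrank_V hUc hlg _ d, _, _, hU.hamiltonian_toLin hUc hlg hl hd,
    hU.hamiltonian_toLin hUc hlg (fun i => by ring) hd', ?_⟩
  rw [Matrix.charpoly_toLin, Matrix.charpoly_toLin, charpoly_heunMatrix (e_sum P) hd]
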